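/- Let $n\ge 0$. A state of the standard box-ball system is a placement of $n$ balls, of the $n$ distinct colours $1,\dots,n$, into boxes indexed by $\mathbb{Z}$, with at most one ball in each box. One step of the time evolution moves each ball exactly once: first the ball of colour $1$, then the ball of colour $2$, and so on up to colour $n$; each is moved to the nearest box on its right that is empty at that moment. Attach to a state the bi-word $\binom{i_1\ \cdots\ i_n}{j_1\ \cdots\ j_n}$, where $i_1<\dots<i_n$ are the labels of the nonempty boxes and $j_k$ is the colour of the ball in box $i_k$, and let $(P,Q)$ be the pair of tableaux of the same shape given by the RSK correspondence: $P$ is obtained by row-inserting $j_1,\dots,j_n$ successively, starting from the empty tableau, and $Q$ is obtained by writing $i_k$ in the box that newly appears when $j_k$ is inserted. Row-inserting $x$ means: if no entry of the first row is larger than $x$, put $x$ in a new box at its right end; otherwise $x$ replaces the leftmost entry larger than $x$, and that entry is inserted in the same way in the next row. **Theorem.** Let a state at time $t$ have pair $(P_t,Q_t)$, and let the state obtained from it by one step of the time evolution have pair $(P_{t+1},Q_{t+1})$. Then: 1. The $P$-symbol is conserved: $P_{t+1}=P_t$. 2. The $Q$-symbol evolves independently of the $P$-symbol: there is a map $F$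 from tableaux to tableaux, depending on $n$ only, such that $Q_{t+1}=F(Q_t)$ for every state. -/

import Mathlib

namespace BoxBall

/-! ### Tableaux and the RSK correspondence -/

/-- A filling of a left-justified array of boxes by integers, given by the list of its rows from top
to bottom, each row being read from left to right. Young tableaux are recorded in this form; the
empty tableau is `[]`. -/
abbrev Tableau : Type := List (List ℤ)

/-- Insert `x` in one row. If no entry is larger than `x`, then `x` is put in a new box at the right
end and nothing is bumped. Otherwise `x` replaces the leftmost entry larger than `x`, which is bumped
out and returned as second component. -/
def rowInsert : List ℤ → ℤ → List ℤ × Option ℤ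
  | [], x => ([x], none)
  | y :: r, x =>
    if x < y then (x :: r, some y)
    else (y :: (rowInsert r x).1, (rowInsert r x).2)

/-- The bumping `T ← x`: insert `x` in the first row, the bumped entry (if there is one) in the second
row, and so on. The second component is the index, counted from `0` at the top, of the row at whose
right end the new box has appeared. -/
def bump : Tableau → ℤ → Tableau × ℕ
  | [], x => ([[x]], 0)
  | r :: T, x =>
    match rowInsert r x with
    | (r', none) => (r' :: T, 0)
    | (r', some y) => (r' :: (bump T y).1, (bump T y).2 + 1)

/-- Add a box containing `i` at the right end of the row with index `m` (a new row if that row is the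
first one below the tableau). -/
def addBox : Tableau → ℕ → ℤ → Tableau
  | [], _, i => [[i]]
  | r :: T, 0, i => (r ++ [i]) :: T
  | r :: T, m + 1, i => r :: addBox T m i

/-- One step of RSK for the column `c = (i, j)` (top entry `i`, bottom entry `j`): bump `j` into `P`,
and write `i` in `Q` in the box that has newly appeared. -/
def rskStep (PQ : Tableau × Tableau) (c : ℤ × ℤ) : Tableau × Tableau :=
  ((bump PQ.1 c.2).1, addBox PQ.2 (bump PQ.1 c.2).2 c.1)

/-- The pair `(P, Q)` attached to a bi-word (the list of its columns (top entry, bottom entry)) by the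
RSK correspondence. -/
def rsk (w : List (ℤ × ℤ)) : Tableau × Tableau :=
  w.foldl rskStep ([], [])

/-! ### The standard box-ball system -/

/-- A state of the standard box-ball system with `n` balls: the ball of colour `k + 1`
(`k = 0, …, n - 1`) lies in the box `s k`, and no box contains two balls. -/
abbrev State (n : ℕ) : Type := Fin n ↪ ℤ

theorem exists_empty_right {n : ℕ} (s : State n) (k : Fin n) :
    ∃ d : ℕ, ∀ l : Fin n, s l ≠ s k + 1 + (d : ℤ) := by
  obtain ⟨M, hM⟩ := (Set.finite_range s).bddAbove
  refine ⟨(M - s k).toNat, fun l h => ?_⟩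
  have h1 : s l ≤ M := hM ⟨l, rfl⟩
  have h2 : s k ≤ M := hM ⟨k, rfl⟩
  omega

/-- The nearest empty box to the right of the ball with index `k`. -/
def nearestEmpty {n : ℕ} (s : State n) (k : Fin n) : ℤ :=
  s k + 1 + (Nat.find (exists_empty_right s k) : ℤ)

theorem nearestEmpty_empty {n : ℕ} (s : State n) (k l : Fin n) : s l ≠ nearestEmpty s k :=
  Nat.find_spec (exists_empty_right s k) l

/-- Move the ball with index `k` to the nearest empty box on its right. -/
def moveBall {n : ℕ} (s : State n) (k : Fin n) : State n where
  toFun := Function.update s k (nearestEmpty s k)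
  inj' := by
    intro a b h
    by_cases ha : a = k <;> by_cases hb : b = k
    · rw [ha, hb]
    · subst ha
      rw [Function.update_self, Function.update_of_ne hb] at h
      exact absurd h.symm (nearestEmpty_empty s a b)
    · subst hb
      rw [Function.update_self, Function.update_of_ne ha] at h
      exact absurd h (nearestEmpty_empty s b a)
    · rw [Function.update_of_ne ha, Function.update_of_ne hb] at h
      exact s.injective h

/-- One step of the time evolution: the balls are moved once each, in the order of their colours. -/
def step {n : ℕ} (s : State n) : State n :=
  (List.finRange n).foldl moveBall s

/-- The bi-word of a state: the columns (box-label, ball-colour) of all nonempty boxes, from left to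
right. -/
def biword {n : ℕ} (s : State n) : List (ℤ × ℤ) :=
  (List.ofFn fun k : Fin n => (s k, (k : ℤ) + 1)).insertionSort fun c d => c.1 ≤ d.1

/-- The `P`-symbol of a state. -/
def pSymbol {n : ℕ} (s : State n) : Tableau := (rsk (biword s)).1

/-- The `Q`-symbol of a state. -/
def qSymbol {n : ℕ} (s : State n) : Tableau := (rsk (biword s)).2

end BoxBall

namespace BoxBall

/-! ### Inserting into a tableau with a largest entry -/

/-! Both parts rest on one fact: two words have the same insertion tableau exactly when they are
Knuth equivalent (`knuthEquiv_of_insertWord_eq`, `KnuthEquiv.insertWord_eq`).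

For P, let a carrier sweep the boxes from left to right, holding the sorted colours of the balls in
transit. At an occupied box it takes in the ball by row insertion and drops the bumped colour; at an
empty box it drops its smallest colour. Each exchange is a Knuth equivalence (`knuthEquiv_carrier`),
and the carrier is empty far to the left and far to the right. So the colour words before and after
the step are Knuth equivalent.

For Q, the symmetry of RSK (`rsk_snd_of_perm`) makes the Q-symbol the insertion tableau of the word
of positions listed by colour (`qSymbol_eq`). Time evolution moves the letters of this word in
order, each to the next free integer, and this operation respects Knuth equivalence
(`moveAll_triple`, `KnuthEquiv.moveAll`). Hence equal Q-symbols evolve to equal Q-symbols, which is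
the existence of F. -/

theorem rowInsert_of_forall_le {r : List ℤ} {x : ℤ} (h : ∀ y ∈ r, y ≤ x) :
    rowInsert r x = (r ++ [x], none) := by
  induction r with
  | nil => rfl
  | cons y r ih =>
    have hy := h y (by simp)
    rw [rowInsert, if_neg (by omega), ih fun z hz => h z (by simp [hz])]
    rfl

theorem eq_of_rowInsert_eq_none {r r' : List ℤ} {x : ℤ} (h : rowInsert r x = (r', none)) :
    r' = r ++ [x] ∧ ∀ y ∈ r, y ≤ x := by
  induction r generalizing r' with
  | nil => simp [rowInsert] at h; simp [h]
  | cons y r ih =>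
    rw [rowInsert] at h
    split_ifs at h with hxy
    · simp at h
    · obtain ⟨h1, h2⟩ := Prod.mk.inj h
      obtain ⟨h3, h4⟩ := ih (Prod.ext rfl h2)
      subst h1
      refine ⟨congrArg (y :: ·) h3, ?_⟩
      simp only [List.mem_cons, forall_eq_or_imp]
      exact ⟨by omega, h4⟩

theorem rowInsert_append_of_some {r r' : List ℤ} {x y : ℤ} (h : rowInsert r x = (r', some y))
    (l : List ℤ) : rowInsert (r ++ l) x = (r' ++ l, some y) := by
  induction r generalizing r' with
  | nil => simp [rowInsert] at h
  | cons z r ih =>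
    rw [List.cons_append]
    rw [rowInsert] at h ⊢
    split_ifs at h ⊢ with hxz
    · obtain ⟨h1, h2⟩ := Prod.mk.inj h
      subst h1
      simpa using h2
    · obtain ⟨h1, h2⟩ := Prod.mk.inj h
      rw [ih (Prod.ext rfl h2), ← h1]
      rfl

theorem rowInsert_append_singleton_of_none {r r' : List ℤ} {x M : ℤ} (hM : x < M)
    (h : rowInsert r x = (r', none)) : rowInsert (r ++ [M]) x = (r', some M) := by
  obtain ⟨rfl, hr⟩ := eq_of_rowInsert_eq_none h
  clear h
  induction r with
  | nil => simp [rowInsert, hM]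
  | cons z r ih =>
    have hz := hr z (by simp)
    rw [List.cons_append, rowInsert, if_neg (by omega), ih fun y hy => hr y (by simp [hy])]
    rfl

theorem perm_of_rowInsert {r r' : List ℤ} {x : ℤ} {o : Option ℤ} (h : rowInsert r x = (r', o)) :
    (r ++ [x]).Perm (o.toList ++ r') := by
  induction r generalizing r' with
  | nil => simp [rowInsert] at h; simp [← h.1, ← h.2]
  | cons z r ih =>
    rw [rowInsert] at h
    split_ifs at h with hxz
    · obtain ⟨h1, h2⟩ := Prod.mk.inj h
      subst h1 h2
      simp
    · obtain ⟨h1, h2⟩ := Prod.mk.inj h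
      subst h1 h2
      refine ((ih rfl).cons z).trans ?_
      exact List.perm_middle.symm

theorem bump_cons (r : List ℤ) (T : Tableau) (x : ℤ) :
    bump (r :: T) x = match rowInsert r x with
      | (r', none) => (r' :: T, 0)
      | (r', some y) => (r' :: (bump T y).1, (bump T y).2 + 1) := by
  rcases h : rowInsert r x with ⟨r', _ | y⟩ <;> simp [bump, h]

theorem bump_of_forall_le {T : Tableau} {x : ℤ} (h : ∀ r ∈ T, ∀ y ∈ r, y ≤ x) :
    bump T x = (addBox T 0 x, 0) := by
  cases T with
  | nil => rfl
  | cons r T => rw [bump_cons, rowInsert_of_forall_le (h r (by simp))]; rfl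

theorem bump_snd_le (T : Tableau) (x : ℤ) : (bump T x).2 ≤ T.length := by
  induction T generalizing x with
  | nil => simp [bump]
  | cons r T ih =>
    rw [bump_cons]
    rcases rowInsert r x with ⟨r', _ | y⟩
    · simp
    · simp [ih y]

theorem length_bump_fst (T : Tableau) (x i : ℤ) {S : Tableau} (hS : S.length = T.length) :
    (addBox S (bump T x).2 i).length = (bump T x).1.length := by
  induction T generalizing x S with
  | nil => rw [List.length_eq_zero_iff.1 hS]; rfl
  | cons r T ih =>
    rcases S with _ | ⟨q, S⟩
    · simp at hS
    rw [bump_cons]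
    rcases rowInsert r x with ⟨r', _ | y⟩
    · simpa [addBox] using hS
    · simpa [addBox] using ih y (by simpa using hS)

/-- Bumping into a tableau with a largest entry `M` at the end of the row `m`: the entry `M` moves
down by one row if bumping into the rest of the tableau ends in row `m`, and stays otherwise. -/
theorem bump_addBox {T : Tableau} {m : ℕ} {M x : ℤ} (hT : ∀ r ∈ T, ∀ y ∈ r, y < M) (hx : x < M)
    (hm : m ≤ T.length) :
    bump (addBox T m M) x = if (bump T x).2 = m then (addBox (bump T x).1 (m + 1) M, m + 1)
      else (addBox (bump T x).1 m M, (bump T x).2) := by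
  induction T generalizing m x with
  | nil =>
    obtain rfl : m = 0 := by simpa using hm
    simp [addBox, bump, rowInsert, hx]
  | cons r T ih =>
    have hr := hT r (by simp)
    have hT' : ∀ r ∈ T, ∀ y ∈ r, y < M := fun q hq => hT q (by simp [hq])
    cases m with
    | zero =>
      rw [addBox, bump_cons, bump_cons]
      rcases h : rowInsert r x with ⟨r', _ | y⟩
      · rw [rowInsert_append_singleton_of_none hx h]
        simp only [bump_of_forall_le fun q hq y hy => (hT' q hq y hy).le, if_true, addBox]
      · rw [rowInsert_append_of_some h]
        simp [addBox]
    | succ m =>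
      rw [addBox, bump_cons, bump_cons]
      rcases h : rowInsert r x with ⟨r', _ | y⟩
      · simp [addBox]
      · have hy : y < M := by
          have : y ∈ r ++ [x] := (perm_of_rowInsert h).mem_iff.2 (by simp)
          rcases List.mem_append.1 this with h | h
          · exact hr y h
          · simp at h; omega
        have := ih hT' hy (m := m) (by simpa using hm)
        simp only [this, add_left_inj]
        split_ifs <;> simp [addBox]

theorem mem_addBox {T : Tableau} {m : ℕ} {i y : ℤ} {r : List ℤ} (hr : r ∈ addBox T m i)
    (hy : y ∈ r) : y = i ∨ ∃ q ∈ T, y ∈ q := by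
  induction T generalizing m with
  | nil =>
    obtain rfl : r = [i] := by simpa [addBox] using hr
    simp_all
  | cons q T ih =>
    cases m with
    | zero =>
      rcases List.mem_cons.1 hr with rfl | hr
      · rcases List.mem_append.1 hy with hy | hy
        · exact Or.inr ⟨q, by simp, hy⟩
        · simp_all
      · exact Or.inr ⟨r, by simp [hr], hy⟩
    | succ m =>
      rcases List.mem_cons.1 hr with rfl | hr
      · exact Or.inr ⟨r, by simp, hy⟩
      · rcases ih hr with h | ⟨q', h, h'⟩
        · exact Or.inl h
        · exact Or.inr ⟨q', by simp [h], h'⟩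

theorem mem_bump {T : Tableau} {x y : ℤ} {r : List ℤ} (hr : r ∈ (bump T x).1)
    (hy : y ∈ r) : y = x ∨ ∃ q ∈ T, y ∈ q := by
  induction T generalizing x with
  | nil =>
    obtain rfl : r = [x] := by simpa [bump] using hr
    simp_all
  | cons q T ih =>
    rw [bump_cons] at hr
    rcases h : rowInsert q x with ⟨r', _ | z⟩ <;> rw [h] at hr
    · rcases List.mem_cons.1 hr with rfl | hr
      · have := (perm_of_rowInsert h).mem_iff.2 (by simpa using hy)
        simp only [List.mem_append, List.mem_singleton] at this
        exact this.symm.imp_right fun h => ⟨q, by simp, h⟩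
      · exact Or.inr ⟨r, by simp [hr], hy⟩
    · have hmem : ∀ {a}, a ∈ r' ∨ a = z → a = x ∨ ∃ p ∈ q :: T, a ∈ p := by
        intro a ha
        have := (perm_of_rowInsert h).mem_iff (a := a).2 (by simpa using ha.symm)
        simp only [List.mem_append, List.mem_singleton] at this
        exact this.symm.imp_right fun h => ⟨q, by simp, h⟩
      rcases List.mem_cons.1 hr with rfl | hr
      · exact hmem (Or.inl hy)
      · rcases ih hr with rfl | ⟨p, hp, hyp⟩
        · exact hmem (Or.inr rfl)
        · exact Or.inr ⟨p, by simp [hp], hyp⟩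

/-! ### Symmetry of the RSK correspondence -/

theorem rsk_append_singleton (w : List (ℤ × ℤ)) (c : ℤ × ℤ) :
    rsk (w ++ [c]) = rskStep (rsk w) c := by
  simp [rsk, List.foldl_append]

/-- Only the number of rows is compared, not the full shape: this suffices for the hypothesis `m ≤
T.length` of `bump_addBox` when `m` comes from the other symbol. -/
theorem length_rsk_snd (w : List (ℤ × ℤ)) : (rsk w).2.length = (rsk w).1.length := by
  induction w using List.reverseRecOn with
  | nil => rfl
  | append_singleton w c ih => rw [rsk_append_singleton]; exact length_bump_fst _ _ _ ih

theorem mem_rsk_fst {w : List (ℤ × ℤ)} {r : List ℤ} {y : ℤ} (hr : r ∈ (rsk w).1) (hy : y ∈ r) :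
    ∃ c ∈ w, c.2 = y := by
  induction w using List.reverseRecOn generalizing r with
  | nil => simp [rsk] at hr
  | append_singleton w c ih =>
    rw [rsk_append_singleton] at hr
    rcases mem_bump hr hy with rfl | ⟨q, hq, hyq⟩
    · exact ⟨c, by simp, rfl⟩
    · obtain ⟨d, hd, h⟩ := ih hq hyq
      exact ⟨d, by simp [hd], h⟩

theorem mem_rsk_snd {w : List (ℤ × ℤ)} {r : List ℤ} {y : ℤ} (hr : r ∈ (rsk w).2) (hy : y ∈ r) :
    ∃ c ∈ w, c.1 = y := by
  induction w using List.reverseRecOn generalizing r with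
  | nil => simp [rsk] at hr
  | append_singleton w c ih =>
    rw [rsk_append_singleton] at hr
    rcases mem_addBox hr hy with rfl | ⟨q, hq, hyq⟩
    · exact ⟨c, by simp, rfl⟩
    · obtain ⟨d, hd, h⟩ := ih hq hyq
      exact ⟨d, by simp [hd], h⟩

/-- Adding to a bi-word a column `(i, M)` with the largest bottom entry amounts to bumping `i` into
the `Q`-symbol and recording `M` in the `P`-symbol. -/
theorem rsk_append_cons (u v : List (ℤ × ℤ)) (i M : ℤ) (hM : ∀ c ∈ u ++ v, c.2 < M)
    (hsort : (u ++ (i, M) :: v).Pairwise fun c d => c.1 < d.1) :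
    rsk (u ++ (i, M) :: v) =
      (addBox (rsk (u ++ v)).1 (bump (rsk (u ++ v)).2 i).2 M, (bump (rsk (u ++ v)).2 i).1) := by
  induction v using List.reverseRecOn with
  | nil =>
    rw [List.append_nil] at hM ⊢
    rw [rsk_append_singleton, rskStep]
    have hP : ∀ r ∈ (rsk u).1, ∀ y ∈ r, y ≤ M := fun r hr y hy => by
      obtain ⟨c, hc, rfl⟩ := mem_rsk_fst hr hy
      exact (hM c hc).le
    have hQ : ∀ r ∈ (rsk u).2, ∀ y ∈ r, y ≤ i := fun r hr y hy => by
      obtain ⟨c, hc, rfl⟩ := mem_rsk_snd hr hy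
      exact ((List.pairwise_append.1 hsort).2.2 c hc (i, M) (by simp)).le
    rw [bump_of_forall_le hP, bump_of_forall_le hQ]
  | append_singleton v c ih =>
    have hsort' : ((u ++ (i, M) :: v) ++ [c]).Pairwise fun c d => c.1 < d.1 := by
      simpa using hsort
    obtain ⟨hs1, -, hs2⟩ := List.pairwise_append.1 hsort'
    have ih := ih (fun d hd => hM d (by
      simp only [List.mem_append] at hd ⊢; tauto)) hs1
    rw [show u ++ (i, M) :: (v ++ [c]) = (u ++ (i, M) :: v) ++ [c] by simp, rsk_append_singleton,
      ih, ← List.append_assoc, rsk_append_singleton, rskStep, rskStep]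
    have hlen := length_rsk_snd (u ++ v)
    have h1 := bump_addBox (T := (rsk (u ++ v)).1) (m := (bump (rsk (u ++ v)).2 i).2) (M := M)
      (x := c.2) (fun r hr y hy => by
        obtain ⟨d, hd, rfl⟩ := mem_rsk_fst hr hy
        exact hM d (by simp only [List.mem_append] at hd ⊢; tauto))
      (hM c (by simp)) (hlen ▸ bump_snd_le _ _)
    have h2 := bump_addBox (T := (rsk (u ++ v)).2) (m := (bump (rsk (u ++ v)).1 c.2).2) (M := c.1)
      (x := i) (fun r hr y hy => by
        obtain ⟨d, hd, rfl⟩ := mem_rsk_snd hr hy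
        exact hs2 d (by simp only [List.mem_append, List.mem_cons] at hd ⊢; tauto) c (by simp))
      (hs2 (i, M) (by simp) c (by simp)) (hlen ▸ bump_snd_le _ _)
    dsimp only
    rw [h1, h2]
    -- If the two bumpings into the symbols of `u ++ v` end in the same row, `M` in P and `c.1` in Q
    -- are both pushed to the next row; otherwise the two operations do not interfere.
    by_cases h : (bump (rsk (u ++ v)).1 c.2).2 = (bump (rsk (u ++ v)).2 i).2
    · rw [if_pos h, if_pos h.symm, h]
    · rw [if_neg h, if_neg (Ne.symm h)]

/-- The result of bumping the letters of a word into a tableau. -/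
def insertWord (T : Tableau) (w : List ℤ) : Tableau :=
  w.foldl (fun T x => (bump T x).1) T

theorem rsk_fst (w : List (ℤ × ℤ)) : (rsk w).1 = insertWord [] (w.map Prod.snd) := by
  induction w using List.reverseRecOn with
  | nil => rfl
  | append_singleton w c ih =>
    rw [rsk_append_singleton, rskStep, ih]
    simp [insertWord, List.foldl_append]

/-- The `Q`-symbol of a bi-word is the `P`-symbol of the bi-word obtained by exchanging the rows. -/
theorem rsk_snd_of_perm {w l : List (ℤ × ℤ)} (h : w.Perm l)
    (hw : w.Pairwise fun c d => c.1 < d.1) (hl : l.Pairwise fun c d => c.2 < d.2) :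
    (rsk w).2 = insertWord [] (l.map Prod.fst) := by
  induction l using List.reverseRecOn generalizing w with
  | nil => rw [h.eq_nil]; rfl
  | append_singleton l c ih =>
    -- `c` has the largest bottom entry, so wherever it stands in `w`, its effect on Q is that of
    -- bumping `c.1` last.
    obtain ⟨u, v, rfl⟩ := List.append_of_mem (h.mem_iff.2 (by simp : c ∈ l ++ [c]))
    have hp : (u ++ v).Perm l := by
      have h1 := List.perm_middle.symm.trans (h.trans (List.perm_append_comm (l₂ := [c])))
      exact h1.cons_inv
    obtain ⟨hl1, -, hl2⟩ := List.pairwise_append.1 hl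
    rw [show c = (c.1, c.2) from rfl, rsk_append_cons u v _ _
      (fun d hd => hl2 d (hp.mem_iff.1 hd) c (by simp)) hw,
      ih hp (hw.sublist ((List.sublist_cons_self _ _).append_left _)) hl1]
    simp [insertWord, List.foldl_append]

/-! ### Knuth equivalence -/

/-- The two elementary Knuth relations between words of three letters. -/
inductive KnuthTriple : List ℤ → List ℤ → Prop
  | yzx {x y z : ℤ} (hxy : x < y) (hyz : y ≤ z) : KnuthTriple [y, z, x] [y, x, z]
  | xzy {x y z : ℤ} (hxy : x ≤ y) (hyz : y < z) : KnuthTriple [x, z, y] [z, x, y]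

/-- An elementary Knuth transformation of a word. -/
inductive KnuthStep : List ℤ → List ℤ → Prop
  | mk (u v : List ℤ) {a b : List ℤ} (h : KnuthTriple a b) : KnuthStep (u ++ a ++ v) (u ++ b ++ v)

/-- Knuth equivalence of words. -/
abbrev KnuthEquiv : List ℤ → List ℤ → Prop := Relation.EqvGen KnuthStep

theorem KnuthTriple.perm {a b : List ℤ} (h : KnuthTriple a b) : a.Perm b := by
  cases h with
  | yzx => exact (List.Perm.swap _ _ _).cons _
  | xzy => exact List.Perm.swap _ _ _

theorem KnuthStep.perm {a b : List ℤ} (h : KnuthStep a b) : a.Perm b := by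
  obtain ⟨u, v, h⟩ := h
  exact (h.perm.append_left u).append_right v

namespace KnuthEquiv

theorem refl (a : List ℤ) : KnuthEquiv a a := Relation.EqvGen.refl a

theorem symm {a b : List ℤ} (h : KnuthEquiv a b) : KnuthEquiv b a := Relation.EqvGen.symm _ _ h

theorem trans {a b c : List ℤ} (h : KnuthEquiv a b) (h' : KnuthEquiv b c) : KnuthEquiv a c :=
  Relation.EqvGen.trans _ _ _ h h'

theorem of_triple {a b : List ℤ} (h : KnuthTriple a b) (u v : List ℤ) :
    KnuthEquiv (u ++ a ++ v) (u ++ b ++ v) :=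
  Relation.EqvGen.rel _ _ (KnuthStep.mk u v h)

theorem perm {a b : List ℤ} (h : KnuthEquiv a b) : a.Perm b := by
  induction h with
  | rel _ _ h => exact h.perm
  | refl => exact List.Perm.refl _
  | symm _ _ _ ih => exact ih.symm
  | trans _ _ _ _ _ ih ih' => exact ih.trans ih'

theorem append {a b : List ℤ} (h : KnuthEquiv a b) (u v : List ℤ) :
    KnuthEquiv (u ++ a ++ v) (u ++ b ++ v) := by
  induction h with
  | rel _ _ h =>
    obtain ⟨u', v', h⟩ := h
    simpa using of_triple h (u ++ u') (v' ++ v)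
  | refl => exact refl _
  | symm _ _ _ ih => exact ih.symm
  | trans _ _ _ _ _ ih ih' => exact ih.trans ih'

theorem append_left {a b : List ℤ} (h : KnuthEquiv a b) (u : List ℤ) :
    KnuthEquiv (u ++ a) (u ++ b) := by
  simpa using h.append u []

theorem append_right {a b : List ℤ} (h : KnuthEquiv a b) (v : List ℤ) :
    KnuthEquiv (a ++ v) (b ++ v) := by
  simpa using h.append [] v

theorem cons {a b : List ℤ} (h : KnuthEquiv a b) (x : ℤ) : KnuthEquiv (x :: a) (x :: b) :=
  h.append_left [x]

end KnuthEquiv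

/-! ### Row insertion and Knuth equivalence -/

theorem rowInsert_snd_gt {r : List ℤ} {x y : ℤ} (h : (rowInsert r x).2 = some y) :
    y ∈ r ∧ x < y := by
  induction r with
  | nil => simp [rowInsert] at h
  | cons z r ih =>
    rw [rowInsert] at h
    split_ifs at h with hxz
    · simp at h; subst h; simp [hxz]
    · obtain ⟨h1, h2⟩ := ih h; simp [h1, h2]

theorem mem_rowInsert (r : List ℤ) (x : ℤ) : x ∈ (rowInsert r x).1 := by
  induction r with
  | nil => simp [rowInsert]
  | cons y r ih =>
    rw [rowInsert]
    split_ifs <;> simp [ih]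

theorem pairwise_rowInsert {r : List ℤ} (hr : r.Pairwise (· ≤ ·)) (x : ℤ) :
    (rowInsert r x).1.Pairwise (· ≤ ·) := by
  induction r with
  | nil => simp [rowInsert]
  | cons y r ih =>
    obtain ⟨h1, h2⟩ := List.pairwise_cons.1 hr
    rw [rowInsert]
    split_ifs with hxy
    · exact List.pairwise_cons.2 ⟨fun z hz => hxy.le.trans (h1 z hz), h2⟩
    · refine List.pairwise_cons.2 ⟨fun z hz => ?_, ih h2⟩
      have : z ∈ r ++ [x] := (perm_of_rowInsert (Prod.eta (rowInsert r x)).symm).mem_iff.2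
        (List.mem_append_right _ hz)
      rcases List.mem_append.1 this with h | h
      · exact h1 z h
      · simp only [List.mem_singleton] at h; omega

/-- The letter `x` travels left through the row one place at a time: `w z x` becomes `w x z`, as `x
< w ≤ z`. It stops behind `y`, where no letter is left to serve as `w`. -/
theorem knuthEquiv_rowInsert_head {x y : ℤ} {r : List ℤ} (hxy : x < y)
    (hr : (y :: r).Pairwise (· ≤ ·)) : KnuthEquiv (y :: r ++ [x]) (y :: x :: r) := by
  induction r using List.reverseRecOn with
  | nil => exact .refl _
  | append_singleton r z ih =>
    have hr' : ((y :: r) ++ [z]).Pairwise (· ≤ ·) := hr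
    obtain ⟨h1, -, h2⟩ := List.pairwise_append.1 hr'
    refine KnuthEquiv.trans ?_ ((ih h1).append_right [z])
    rcases List.eq_nil_or_concat (y :: r) with h | ⟨q, w, h⟩
    · simp at h
    rw [List.concat_eq_append] at h
    have hw : w ∈ y :: r := h ▸ by simp
    have hyw : y ≤ w := by
      rcases List.mem_cons.1 hw with rfl | hw
      · exact le_rfl
      · exact (List.pairwise_cons.1 h1).1 w hw
    have := KnuthEquiv.of_triple (.yzx (x := x) (y := w) (z := z) (by omega)
      (h2 w hw z (by simp))) q []
    rw [← List.cons_append, h]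
    simpa using this

/-- A weakly increasing row followed by `x` is Knuth equivalent to the bumped entry followed by the
row into which `x` has been inserted. -/
theorem knuthEquiv_rowInsert {r : List ℤ} (hr : r.Pairwise (· ≤ ·)) (x : ℤ) :
    KnuthEquiv (r ++ [x]) ((rowInsert r x).2.toList ++ (rowInsert r x).1) := by
  induction r with
  | nil => exact .refl _
  | cons y r ih =>
    rw [rowInsert]
    split_ifs with hxy
    · exact knuthEquiv_rowInsert_head hxy hr
    · obtain ⟨h1, h2⟩ := List.pairwise_cons.1 hr
      refine ((ih h2).cons y).trans ?_
      dsimp only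
      rcases h : rowInsert r x with ⟨r', _ | z⟩
      · exact .refl _
      · have hp := pairwise_rowInsert hr x
        have hx := mem_rowInsert r x
        rw [rowInsert, if_neg hxy, h] at hp
        rw [h] at hx
        obtain ⟨hp1, hp2⟩ := List.pairwise_cons.1 hp
        have hz := (rowInsert_snd_gt (congrArg Prod.snd h)).2
        rcases r' with _ | ⟨w, r'⟩
        · simp at hx
        -- The bumped `z` must still pass in front of `y`. The head `w` of the new row is the
        -- witness: `y ≤ w ≤ x < z`, so `y z w` becomes `z y w`.
        have hwx : w ≤ x := by
          rcases List.mem_cons.1 hx with rfl | hx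
          · exact le_rfl
          · exact (List.pairwise_cons.1 hp2).1 x hx
        exact KnuthEquiv.of_triple (.xzy (hp1 w (by simp)) (hwx.trans_lt hz)) [] r'

/-! ### The word of a tableau -/

/-- The rows of a tableau, read from the bottom row to the top row. -/
def readingWord : Tableau → List ℤ
  | [] => []
  | r :: T => readingWord T ++ r

theorem bump_cons_fst (r : List ℤ) (T : Tableau) (x : ℤ) :
    (bump (r :: T) x).1 = (rowInsert r x).1 :: insertWord T (rowInsert r x).2.toList := by
  rw [bump_cons]
  rcases rowInsert r x with ⟨r', _ | y⟩ <;> rfl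

theorem pairwise_bump {T : Tableau} (hT : ∀ r ∈ T, r.Pairwise (· ≤ ·)) (x : ℤ) :
    ∀ r ∈ (bump T x).1, r.Pairwise (· ≤ ·) := by
  induction T generalizing x with
  | nil => simp [bump]
  | cons q T ih =>
    have hT' : ∀ r ∈ T, r.Pairwise (· ≤ ·) := fun r hr => hT r (by simp [hr])
    rw [bump_cons_fst]
    intro r hr
    rcases List.mem_cons.1 hr with rfl | hr
    · exact pairwise_rowInsert (hT q (by simp)) x
    · rcases h : (rowInsert q x).2 with _ | y <;> rw [h] at hr
      · exact hT' r hr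
      · exact ih hT' y r hr

theorem pairwise_insertWord {T : Tableau} (hT : ∀ r ∈ T, r.Pairwise (· ≤ ·)) (w : List ℤ) :
    ∀ r ∈ insertWord T w, r.Pairwise (· ≤ ·) := by
  induction w generalizing T with
  | nil => exact hT
  | cons x w ih => exact ih (pairwise_bump hT x)

/-- A bumped entry comes out just in front of its row, that is, right behind the reading word of the
rows below, where it is the next letter to insert. -/
theorem knuthEquiv_readingWord_bump {T : Tableau} (hT : ∀ r ∈ T, r.Pairwise (· ≤ ·)) (x : ℤ) :
    KnuthEquiv (readingWord T ++ [x]) (readingWord (bump T x).1) := by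
  induction T generalizing x with
  | nil => exact .refl _
  | cons q T ih =>
    have h := (knuthEquiv_rowInsert (hT q (by simp)) x).append_left (readingWord T)
    rw [bump_cons_fst, readingWord, readingWord, List.append_assoc]
    refine h.trans ?_
    rcases (rowInsert q x).2 with _ | y
    · exact .refl _
    · rw [← List.append_assoc]
      exact (ih (fun r hr => hT r (by simp [hr])) y).append_right (rowInsert q x).1

theorem knuthEquiv_readingWord_insertWord {T : Tableau} (hT : ∀ r ∈ T, r.Pairwise (· ≤ ·))
    (w : List ℤ) : KnuthEquiv (readingWord T ++ w) (readingWord (insertWord T w)) := by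
  induction w generalizing T with
  | nil => rw [List.append_nil]; exact .refl _
  | cons x w ih =>
    refine KnuthEquiv.trans ?_ (ih (pairwise_bump hT x))
    simpa using (knuthEquiv_readingWord_bump hT x).append_right w

/-- Both words are equivalent to the reading word of their common tableau. -/
theorem knuthEquiv_of_insertWord_eq {a b : List ℤ} (h : insertWord [] a = insertWord [] b) :
    KnuthEquiv a b := by
  have ha := knuthEquiv_readingWord_insertWord (T := []) (by simp) a
  have hb := knuthEquiv_readingWord_insertWord (T := []) (by simp) b
  rw [h] at ha
  exact ha.trans hb.symm

/-! ### Knuth equivalent words have the same `P`-symbol -/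

/-- Insert the letters of a word in a row; the second component is the word of the bumped entries. -/
def rowInsertWord : List ℤ → List ℤ → List ℤ × List ℤ
  | r, [] => (r, [])
  | r, x :: w => ((rowInsertWord (rowInsert r x).1 w).1,
      (rowInsert r x).2.toList ++ (rowInsertWord (rowInsert r x).1 w).2)

theorem insertWord_append (T : Tableau) (a b : List ℤ) :
    insertWord T (a ++ b) = insertWord (insertWord T a) b :=
  List.foldl_append

theorem insertWord_cons (r : List ℤ) (T : Tableau) (w : List ℤ) :
    insertWord (r :: T) w = (rowInsertWord r w).1 :: insertWord T (rowInsertWord r w).2 := by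
  induction w generalizing r T with
  | nil => rfl
  | cons x w ih =>
    rw [show insertWord (r :: T) (x :: w) = insertWord (bump (r :: T) x).1 w from rfl,
      bump_cons_fst, ih, rowInsertWord, insertWord_append]

/-- Inserting `x ≤ x'` successively in a row bumps out weakly increasing entries, the second only if
the first exists. -/
theorem rowInsert_rowInsert_snd {r : List ℤ} (hr : r.Pairwise (· ≤ ·)) {x x' : ℤ} (hx : x ≤ x') :
    ∀ z ∈ (rowInsert (rowInsert r x).1 x').2, ∃ y ∈ (rowInsert r x).2, y ≤ z := by
  induction r with
  | nil => simp [rowInsert, not_lt.2 hx]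
  | cons a r ih =>
    obtain ⟨h1, h2⟩ := List.pairwise_cons.1 hr
    intro z hz
    rw [rowInsert] at hz ⊢
    split_ifs at hz ⊢ with hxa
    · rw [rowInsert, if_neg (by omega)] at hz
      exact ⟨a, by simp, h1 z (rowInsert_snd_gt hz).1⟩
    · rw [rowInsert, if_neg (by omega)] at hz
      exact ih h2 z hz

/-- If `z` and then some `y < z` are inserted in a row, then `y` bumps out an entry which is at most
`z`. -/
theorem rowInsert_rowInsert_snd_of_lt {r : List ℤ} (hr : r.Pairwise (· ≤ ·)) {y z : ℤ}
    (hyz : y < z) : ∃ y' ∈ (rowInsert (rowInsert r z).1 y).2, y' ≤ z := by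
  induction r with
  | nil => simp [rowInsert, hyz]
  | cons a r ih =>
    obtain ⟨h1, h2⟩ := List.pairwise_cons.1 hr
    rw [rowInsert]
    split_ifs with hza
    · exact ⟨z, by simp [rowInsert, hyz], le_rfl⟩
    · rw [rowInsert]
      split_ifs with hya
      · exact ⟨a, by simp, by omega⟩
      · exact ih h2

/-- Two words of three letters related by an elementary Knuth relation give the same row, and words of
bumped entries that are equal or again related. -/
theorem rowInsertWord_triple {r a b : List ℤ} (hr : r.Pairwise (· ≤ ·)) (h : KnuthTriple a b) :
    (rowInsertWord r a).1 = (rowInsertWord r b).1 ∧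
      ((rowInsertWord r a).2 = (rowInsertWord r b).2 ∨
        KnuthTriple (rowInsertWord r a).2 (rowInsertWord r b).2) := by
  induction r with
  | nil =>
    cases h with
    | yzx hxy hyz =>
      simp [rowInsertWord, rowInsert, hxy, show ¬ _ from not_lt.2 hyz,
        show ¬ _ from not_lt.2 (hxy.le.trans hyz)]
    | xzy hxy hyz =>
      simp [rowInsertWord, rowInsert, hyz, show ¬ _ from not_lt.2 hxy,
        show ¬ _ from not_lt.2 (hxy.trans hyz.le), hxy.trans_lt hyz]
  | cons c r ih =>
    obtain ⟨h1, h2⟩ := List.pairwise_cons.1 hr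
    have ih := ih h2
    cases h with
    | @yzx x y z hxy hyz =>
      by_cases hcx : c ≤ x
      · simpa [rowInsertWord, rowInsert, not_lt.2 hcx, not_lt.2 (hcx.trans hxy.le),
          not_lt.2 (hcx.trans (hxy.le.trans hyz))] using ih
      -- Here `x` bumps `c`, while `y` and `z` pass into `r`. The bumped words are `y' z' c` and `y'
      -- c z'` with `c < y' ≤ z'`.
      by_cases hcy : c ≤ y
      · clear ih
        have hz := rowInsert_rowInsert_snd h2 hyz
        simp only [rowInsertWord, rowInsert, not_lt.2 hcy, not_le.1 hcx,
          not_lt.2 (hcy.trans hyz), not_lt.2 (hxy.le.trans hyz), if_true, if_false]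
        refine ⟨trivial, ?_⟩
        rcases hz' : (rowInsert (rowInsert r y).1 z).2 with _ | z'
        · simp
        · obtain ⟨y', hy', hyz'⟩ := hz z' hz'
          rw [hy']
          exact Or.inr (.yzx (by have := (rowInsert_snd_gt hy').2; omega) hyz')
      · simp only [rowInsertWord, rowInsert, not_le.1 hcy, hxy, not_lt.2 hyz,
          not_lt.2 (hxy.le.trans hyz), if_true, if_false]
        refine ⟨trivial, ?_⟩
        rcases hz' : (rowInsert r z).2 with _ | z'
        · simp
        · exact Or.inr (.yzx (not_le.1 hcy) (h1 z' (rowInsert_snd_gt hz').1))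
    | @xzy x y z hxy hyz =>
      have hxz := hxy.trans_lt hyz
      by_cases hcx : c ≤ x
      · simpa [rowInsertWord, rowInsert, not_lt.2 hcx, not_lt.2 (hcx.trans hxy),
          not_lt.2 (hcx.trans hxz.le)] using ih
      clear ih
      by_cases hcz : c ≤ z
      · simp only [rowInsertWord, rowInsert, not_le.1 hcx, not_lt.2 hcz, not_lt.2 hxy,
          not_lt.2 hxz.le, if_true, if_false]
        refine ⟨trivial, ?_⟩
        obtain ⟨y', hy', hyz'⟩ := rowInsert_rowInsert_snd_of_lt h2 hyz
        rw [hy']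
        rcases hz' : (rowInsert r z).2 with _ | z'
        · simp
        · have hy'' : c ≤ y' := by
            rcases List.mem_append.1 ((perm_of_rowInsert (Prod.eta (rowInsert r z)).symm).mem_iff.2
              (List.mem_append_right _ (rowInsert_snd_gt hy').1)) with h | h
            · exact h1 _ h
            · simp only [List.mem_singleton] at h; omega
          have := (rowInsert_snd_gt hz').2
          exact Or.inr (.xzy hy'' (by omega))
      -- Here the type of the relation changes: the bumped words are `c d z` and `c z d` with `z < c
      -- ≤ d`, where `d` is the second entry of the row. If there is no `d`, both are `c z`.
      · have hxc := not_le.1 hcx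
        rcases r with _ | ⟨d, r⟩
        · simp [rowInsertWord, rowInsert, not_le.1 hcz, hxc, hxz, hyz, not_lt.2 hxy,
            not_lt.2 hxz.le]
        · have hcd := h1 d (by simp)
          have hzd : z < d := by omega
          have hyd : y < d := by omega
          simp only [rowInsertWord, rowInsert, not_le.1 hcz, hxc, hxz, hyz, hzd, hyd, not_lt.2 hxy,
            not_lt.2 hxz.le, if_true, if_false]
          exact ⟨trivial, Or.inr (.yzx (not_le.1 hcz) hcd)⟩

/-- By `rowInsertWord_triple` the first rows agree and the words handed to the next row are equal or
again related, so induction on the rows applies. -/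
theorem insertWord_triple {T : Tableau} (hT : ∀ r ∈ T, r.Pairwise (· ≤ ·)) {a b : List ℤ}
    (h : KnuthTriple a b) : insertWord T a = insertWord T b := by
  induction T generalizing a b with
  | nil =>
    cases h with
    | yzx hxy hyz =>
      simp [insertWord, bump, rowInsert, hxy, show ¬ _ from not_lt.2 hyz,
        show ¬ _ from not_lt.2 (hxy.le.trans hyz)]
    | xzy hxy hyz =>
      simp [insertWord, bump, rowInsert, hyz, show ¬ _ from not_lt.2 hxy,
        show ¬ _ from not_lt.2 (hxy.trans hyz.le), hxy.trans_lt hyz]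
  | cons r T ih =>
    obtain ⟨h1, h2⟩ := rowInsertWord_triple (hT r (by simp)) h
    rw [insertWord_cons, insertWord_cons, h1]
    rcases h2 with h2 | h2
    · rw [h2]
    · rw [ih (fun q hq => hT q (by simp [hq])) h2]

theorem KnuthEquiv.insertWord_eq {a b : List ℤ} (h : KnuthEquiv a b) :
    insertWord [] a = insertWord [] b := by
  induction h with
  | rel _ _ h =>
    obtain ⟨u, v, h⟩ := h
    rw [insertWord_append, insertWord_append, insertWord_append, insertWord_append,
      insertWord_triple (pairwise_insertWord (by simp) u) h]
  | refl => rfl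
  | symm _ _ _ ih => exact ih.symm
  | trans _ _ _ _ _ ih ih' => exact ih.trans ih'

/-! ### The time evolution on lists of positions -/

/-- The least integer larger than `x` outside a finite set. -/
noncomputable def nextFree (S : Finset ℤ) (x : ℤ) : ℤ := sInf {t | x < t ∧ t ∉ S}

theorem isLeast_nextFree (S : Finset ℤ) (x : ℤ) : IsLeast {t | x < t ∧ t ∉ S} (nextFree S x) := by
  have hb : BddBelow {t | x < t ∧ t ∉ S} := ⟨x, fun t ht => ht.1.le⟩
  have hne : {t | x < t ∧ t ∉ S}.Nonempty := by
    obtain ⟨M, hM⟩ := S.bddAbove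
    refine ⟨max M x + 1, by have := le_max_right M x; omega, fun h => ?_⟩
    have := hM h
    have := le_max_left M x
    omega
  exact ⟨Int.csInf_mem hne hb, fun t ht => csInf_le hb ht⟩

/-- Move the balls at the positions in the list one after another to the nearest empty box on the
right, the boxes in `S` being occupied by other balls. -/
noncomputable def moveAll (S : Finset ℤ) : List ℤ → List ℤ
  | [] => []
  | x :: w => nextFree (S ∪ w.toFinset) x :: moveAll (insert (nextFree (S ∪ w.toFinset) x) S) w

theorem moveAll_ofFn {n : ℕ} (S : Finset ℤ) (s t : Fin n → ℤ)
    (h : ∀ k, IsLeast {x | s k < x ∧ x ∉ S ∧ (∀ l, k < l → s l ≠ x) ∧ ∀ l, l < k → t l ≠ x} (t k)) :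
    moveAll S (List.ofFn s) = List.ofFn t := by
  induction n generalizing S with
  | zero => simp [moveAll]
  | succ n ih =>
    have h0 : nextFree (S ∪ (List.ofFn fun i : Fin n => s i.succ).toFinset) (s 0) = t 0 := by
      have h0 : IsLeast {x | s 0 < x ∧ x ∉ S ∪ (List.ofFn fun i : Fin n => s i.succ).toFinset}
          (t 0) := by
        convert h 0 using 3 with x
        simp [Fin.forall_fin_succ, List.mem_ofFn]
      exact (isLeast_nextFree _ _).unique h0
    rw [List.ofFn_succ, List.ofFn_succ, moveAll, h0]
    congr 1
    refine ih _ _ _ fun k => ?_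
    convert h k.succ using 3 with x
    simp only [Finset.mem_insert, not_or, Fin.forall_fin_succ, Fin.succ_lt_succ_iff, Fin.not_lt_zero,
      Fin.succ_pos, false_imp_iff, true_imp_iff, true_and, ne_comm (a := t 0), ne_eq]
    tauto

/-- The three balls end up occupying the same boxes in either order, so the remaining letters `v`
see the same occupied set `S'`. The new triple is related again, though possibly by the other
relation. -/
theorem moveAll_triple {S : Finset ℤ} {a b v : List ℤ} (h : KnuthTriple a b)
    (hS : ∀ x ∈ a ++ v, x ∉ S) (hv : (a ++ v).Nodup) :
    ∃ a' b' S', moveAll S (a ++ v) = a' ++ moveAll S' v ∧ moveAll S (b ++ v) = b' ++ moveAll S' v ∧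
      KnuthTriple a' b' := by
  cases h with
  | @yzx x y z hxy hyz =>
    simp only [List.cons_append, List.nil_append, moveAll]
    generalize hy1 : nextFree (S ∪ (z :: x :: v).toFinset) y = y1
    generalize hy1' : nextFree (S ∪ (x :: z :: v).toFinset) y = y1'
    generalize hz1 : nextFree (insert y1 S ∪ (x :: v).toFinset) z = z1
    generalize hx1 : nextFree (insert z1 (insert y1 S) ∪ v.toFinset) x = x1
    generalize hx1' : nextFree (insert y1' S ∪ (z :: v).toFinset) x = x1'
    generalize hz1' : nextFree (insert x1' (insert y1' S) ∪ v.toFinset) z = z1'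
    have Hy := hy1 ▸ isLeast_nextFree (S ∪ (z :: x :: v).toFinset) y
    have Hy' := hy1' ▸ isLeast_nextFree (S ∪ (x :: z :: v).toFinset) y
    have Hz := hz1 ▸ isLeast_nextFree (insert y1 S ∪ (x :: v).toFinset) z
    have Hx := hx1 ▸ isLeast_nextFree (insert z1 (insert y1 S) ∪ v.toFinset) x
    have Hx' := hx1' ▸ isLeast_nextFree (insert y1' S ∪ (z :: v).toFinset) x
    have Hz' := hz1' ▸ isLeast_nextFree (insert x1' (insert y1' S) ∪ v.toFinset) z
    clear hy1 hy1' hz1 hx1 hx1' hz1'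
    simp only [IsLeast, lowerBounds, Set.mem_ofPred_eq, Finset.mem_union, Finset.mem_insert,
      List.mem_toFinset, List.mem_cons, not_or, and_imp] at Hy Hy' Hz Hx Hx' Hz'
    simp only [List.cons_append, List.nil_append, List.mem_cons, List.nodup_cons] at hS hv
    -- Once `y` has left, its box is free for `x`, so `x1 ≤ y < z`: the moves of `x` and `z` do not
    -- interfere.
    obtain rfl : y1 = y1' := by grind
    obtain rfl : x1 = x1' := by grind
    obtain rfl : z1 = z1' := by grind
    refine ⟨[y1, z1, x1], [y1, x1, z1], insert x1 (insert z1 (insert y1 S)), rfl, ?_, .yzx ?_ ?_⟩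
    · rw [Finset.insert_comm]; rfl
    · grind
    · grind
  | @xzy x y z hxy hyz =>
    simp only [List.cons_append, List.nil_append, moveAll]
    generalize hx1 : nextFree (S ∪ (z :: y :: v).toFinset) x = x1
    generalize hz1 : nextFree (insert x1 S ∪ (y :: v).toFinset) z = z1
    generalize hy1 : nextFree (insert z1 (insert x1 S) ∪ v.toFinset) y = y1
    generalize hz1' : nextFree (S ∪ (x :: y :: v).toFinset) z = z1'
    generalize hx1' : nextFree (insert z1' S ∪ (y :: v).toFinset) x = x1'
    generalize hy1' : nextFree (insert x1' (insert z1' S) ∪ v.toFinset) y = y1'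
    have Hx := hx1 ▸ isLeast_nextFree (S ∪ (z :: y :: v).toFinset) x
    have Hz := hz1 ▸ isLeast_nextFree (insert x1 S ∪ (y :: v).toFinset) z
    have Hy := hy1 ▸ isLeast_nextFree (insert z1 (insert x1 S) ∪ v.toFinset) y
    have Hz' := hz1' ▸ isLeast_nextFree (S ∪ (x :: y :: v).toFinset) z
    have Hx' := hx1' ▸ isLeast_nextFree (insert z1' S ∪ (y :: v).toFinset) x
    have Hy' := hy1' ▸ isLeast_nextFree (insert x1' (insert z1' S) ∪ v.toFinset) y
    clear hy1 hy1' hz1 hx1 hx1' hz1'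
    simp only [IsLeast, lowerBounds, Set.mem_ofPred_eq, Finset.mem_union, Finset.mem_insert,
      List.mem_toFinset, List.mem_cons, not_or, and_imp] at Hy Hy' Hz Hx Hx' Hz'
    simp only [List.cons_append, List.nil_append, List.mem_cons, List.nodup_cons] at hS hv
    -- If `x` jumps over `z`, all boxes between `x` and `x1` are taken. When `z` moves first, it
    -- goes to `x1` and `x` takes the box `z`; when `x` moves first, `y` later takes the box `z`.
    -- The results are `x1 z1 z` and `x1 z z1` with `z < x1 ≤ z1`. Otherwise each ball has the same
    -- target in both orders.
    by_cases hxz : z < x1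
    · obtain rfl : x1 = z1' := by grind
      obtain rfl : x1' = z := by grind
      obtain rfl : y1 = x1' := by grind
      obtain rfl : z1 = y1' := by grind
      refine ⟨[x1, z1, y1], [x1, y1, z1], insert y1 (insert z1 (insert x1 S)), rfl, ?_, .yzx ?_ ?_⟩
      · rw [Finset.insert_comm]; rfl
      · grind
      · grind
    · obtain rfl : x1 = x1' := by grind
      obtain rfl : z1 = z1' := by grind
      obtain rfl : y1 = y1' := by grind
      refine ⟨[x1, z1, y1], [z1, x1, y1], insert y1 (insert z1 (insert x1 S)), rfl, ?_, .xzy ?_ ?_⟩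
      · rw [Finset.insert_comm z1]; rfl
      · grind
      · grind

/-- The move of a letter before the triple depends only on the set of letters still to come, which
the Knuth step does not change. -/
theorem moveAll_step {S : Finset ℤ} {a b : List ℤ} (h : KnuthStep a b)
    (hS : ∀ x ∈ a, x ∉ S) (hv : a.Nodup) : KnuthEquiv (moveAll S a) (moveAll S b) := by
  obtain ⟨u, v, h⟩ := h
  induction u generalizing S with
  | nil =>
    obtain ⟨a', b', S', h1, h2, h3⟩ := moveAll_triple h hS hv
    rw [List.nil_append, List.nil_append, h1, h2]
    exact KnuthEquiv.of_triple h3 [] _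
  | cons x u ih =>
    have hp := (KnuthStep.mk u v h).perm
    simp only [List.cons_append, moveAll]
    rw [← List.toFinset_eq_of_perm _ _ hp]
    refine (ih (fun y hy hmem => ?_) (List.nodup_cons.1 hv).2).cons _
    rcases Finset.mem_insert.1 hmem with rfl | hmem
    · exact (isLeast_nextFree _ _).1.2 (Finset.mem_union_right _ (List.mem_toFinset.2 hy))
    · exact hS y (List.mem_cons_of_mem _ hy) hmem

theorem KnuthEquiv.moveAll {a b : List ℤ} (h : KnuthEquiv a b) (ha : a.Nodup) :
    KnuthEquiv (moveAll ∅ a) (moveAll ∅ b) := by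
  induction h with
  | rel _ _ h => exact moveAll_step h (by simp) ha
  | refl => exact .refl _
  | symm _ _ h ih => exact (ih ((KnuthEquiv.perm h).nodup_iff.2 ha)).symm
  | trans _ _ _ h _ ih ih' => exact (ih ha).trans (ih' ((KnuthEquiv.perm h).nodup_iff.1 ha))

/-! ### Description of the time evolution -/

variable {n : ℕ}

theorem isLeast_nearestEmpty (s : State n) (k : Fin n) :
    IsLeast {x | s k < x ∧ ∀ l, s l ≠ x} (nearestEmpty s k) := by
  refine ⟨⟨by unfold nearestEmpty; omega, nearestEmpty_empty s k⟩, fun x hx => ?_⟩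
  have h : Nat.find (exists_empty_right s k) ≤ (x - s k - 1).toNat := by
    refine Nat.find_min' _ fun l hl => hx.2 l ?_
    have := hx.1
    omega
  have := hx.1
  unfold nearestEmpty
  omega

theorem moveBall_apply_self (s : State n) (k : Fin n) : moveBall s k k = nearestEmpty s k :=
  Function.update_self ..

theorem moveBall_apply_of_ne (s : State n) {k l : Fin n} (h : l ≠ k) : moveBall s k l = s l :=
  Function.update_of_ne h ..

theorem foldl_moveBall_apply_of_notMem (s : State n) {L : List (Fin n)} {l : Fin n} (h : l ∉ L) :
    L.foldl moveBall s l = s l := by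
  induction L generalizing s with
  | nil => rfl
  | cons k L ih =>
    rw [List.mem_cons, not_or] at h
    rw [List.foldl_cons, ih _ h.2, moveBall_apply_of_ne s h.1]

/-- The ball `k` moves to the nearest box on its right which contains neither the old position of a
ball of larger colour nor the new position of a ball of smaller colour. -/
theorem isLeast_step (s : State n) (k : Fin n) :
    IsLeast {x | s k < x ∧ (∀ l, k < l → s l ≠ x) ∧ ∀ l, l < k → step s l ≠ x} (step s k) := by
  obtain ⟨L₁, L₂, hL⟩ := List.append_of_mem (List.mem_finRange k)
  have hlt : (L₁ ++ k :: L₂).Pairwise (· < ·) := hL ▸ List.pairwise_lt_finRange n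
  obtain ⟨-, h2, h1⟩ := List.pairwise_append.1 hlt
  have h2 := (List.pairwise_cons.1 h2).1
  have h1 : ∀ l ∈ L₁, l < k := fun l hl => h1 l hl k (by simp)
  have hstep : step s = L₂.foldl moveBall (moveBall (L₁.foldl moveBall s) k) := by
    rw [step, hL, List.foldl_append, List.foldl_cons]
  have hk : step s k = nearestEmpty (L₁.foldl moveBall s) k := by
    rw [hstep, foldl_moveBall_apply_of_notMem _ fun h => lt_irrefl _ (h2 _ h),
      moveBall_apply_self]
  have hge : ∀ l, k ≤ l → L₁.foldl moveBall s l = s l := fun l hl =>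
    foldl_moveBall_apply_of_notMem _ fun h => (h1 l h).not_ge hl
  have hl : ∀ l, l < k → L₁.foldl moveBall s l = step s l := fun l hl => by
    rw [hstep, foldl_moveBall_apply_of_notMem _ fun h => (h2 l h).not_gt hl,
      moveBall_apply_of_ne _ hl.ne]
  rw [hk]
  convert isLeast_nearestEmpty (L₁.foldl moveBall s) k using 3 with x
  rw [hge k le_rfl]
  refine and_congr_right fun hx => ⟨fun h l => ?_, fun h => ⟨fun l hkl => ?_, fun l hlk => ?_⟩⟩
  · rcases lt_trichotomy l k with h' | rfl | h'
    · rw [hl l h']; exact h.2 l h'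
    · rw [hge l le_rfl]; exact hx.ne
    · rw [hge l h'.le]; exact h.1 l h'
  · rw [← hge l hkl.le]; exact h l
  · rw [← hl l hlk]; exact h l

theorem moveAll_ofFn_state (s : State n) : moveAll ∅ (List.ofFn s) = List.ofFn (step s) :=
  moveAll_ofFn _ _ _ fun k => by simpa using isLeast_step s k

/-! ### The carrier -/

/-- The increasing list of the colours of the balls satisfying `p`. -/
def colours (p : Fin n → Prop) [DecidablePred p] : List ℤ :=
  ((List.finRange n).filter p).map fun k : Fin n => (k : ℤ) + 1

section colours

variable {p q p' q' : Fin n → Prop} [DecidablePred p] [DecidablePred q] [DecidablePred p']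
  [DecidablePred q']

theorem mem_colours {y : ℤ} : y ∈ colours p ↔ ∃ k, p k ∧ (k : ℤ) + 1 = y := by
  simp [colours]

theorem pairwise_colours (p : Fin n → Prop) [DecidablePred p] :
    (colours p).Pairwise (· < ·) := by
  rw [colours, List.pairwise_map]
  exact ((List.pairwise_lt_finRange n).filter _).imp fun h => by
    have := Fin.lt_def.1 h
    omega

theorem colours_eq_nil (h : ∀ k, ¬ p k) : colours p = [] := by
  simp [colours, h]

theorem colours_eq_singleton {k : Fin n} (h : ∀ l, p l ↔ l = k) : colours p = [(k : ℤ) + 1] := by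
  rw [colours, List.filter_congr (q := fun l => l == k) (by simp [h, Bool.beq_eq_decide_eq]), List.filter_beq]
  simp [List.count_eq_one_of_mem (List.nodup_finRange n) (List.mem_finRange k)]

theorem nodup_colours_append (h : ∀ k, p k → ¬ q k) : (colours p ++ colours q).Nodup := by
  refine List.nodup_append.2 ⟨(pairwise_colours p).imp ne_of_lt,
    (pairwise_colours q).imp ne_of_lt, fun a ha b hb hab => ?_⟩
  obtain ⟨k, hk, rfl⟩ := mem_colours.1 ha
  obtain ⟨l, hl, rfl⟩ := mem_colours.1 hb
  obtain rfl : k = l := Fin.ext (by omega)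
  exact h k hk hl

theorem colours_append_perm (h : ∀ k, p k → ¬ q k) (h' : ∀ k, p' k → ¬ q' k)
    (hiff : ∀ k, p k ∨ q k ↔ p' k ∨ q' k) :
    (colours p ++ colours q).Perm (colours p' ++ colours q') := by
  refine (List.perm_ext_iff_of_nodup (nodup_colours_append h) (nodup_colours_append h')).2
    fun y => ?_
  simp only [List.mem_append, mem_colours, ← exists_or, ← or_and_right, hiff]

end colours

theorem rowInsert_snd_le {r : List ℤ} (hr : r.Pairwise (· ≤ ·)) {x y : ℤ}
    (h : (rowInsert r x).2 = some y) {z : ℤ} (hz : z ∈ r) (hxz : x < z) : y ≤ z := by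
  induction r with
  | nil => simp at hz
  | cons a r ih =>
    obtain ⟨h1, h2⟩ := List.pairwise_cons.1 hr
    rw [rowInsert] at h
    split_ifs at h with hxa
    · obtain rfl : a = y := by simpa using h
      rcases List.mem_cons.1 hz with rfl | hz
      · exact le_rfl
      · exact h1 z hz
    · rcases List.mem_cons.1 hz with rfl | hz
      · exact absurd hxz hxa
      · exact ih h2 h hz

theorem lt_step (s : State n) (k : Fin n) : s k < step s k := (isLeast_step s k).1.1

/-- The colours of the balls which are in transit just before the box `x`. -/
def carrier (s : State n) (x : ℤ) : List ℤ := colours fun k => s k < x ∧ x ≤ step s k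

/-- The word of length at most one formed by the ball in the box `x`. -/
def content (s : State n) (x : ℤ) : List ℤ := colours fun k => s k = x

theorem content_eq_singleton {s : State n} {k : Fin n} {x : ℤ} (h : s k = x) :
    content s x = [(k : ℤ) + 1] :=
  colours_eq_singleton fun l => by rw [← h, s.injective.eq_iff]

/-- Both sides list the balls with `s k ≤ x ≤ step s k`. -/
theorem carrier_append_content_perm (s : State n) (x : ℤ) :
    (carrier s x ++ content s x).Perm (content (step s) x ++ carrier s (x + 1)) :=
  colours_append_perm (by omega) (by omega) fun k => by have := lt_step s k; omega

/-- A ball in transit before the box `x` is left there if no other ball in transit of smaller colour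
is left there and the ball that was in the box `x`, if there was one, has a smaller colour. -/
theorem step_eq_of_forall {s : State n} {k : Fin n} {x : ℤ} (h1 : s k < x) (h2 : x ≤ step s k)
    (h3 : ∀ l, k < l → s l ≠ x) (h4 : ∀ l, l < k → step s l ≠ x) : step s k = x :=
  le_antisymm ((isLeast_step s k).2 ⟨h1, h3, h4⟩) h2

/-- Passing the box `x`, the carrier exchanges balls with it by row insertion. -/
theorem knuthEquiv_carrier (s : State n) (x : ℤ) :
    KnuthEquiv (carrier s x ++ content s x) (content (step s) x ++ carrier s (x + 1)) := by
  have hperm := carrier_append_content_perm s x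
  have hsort : (carrier s x).Pairwise (· ≤ ·) := (pairwise_colours _).imp le_of_lt
  have hsort' : (carrier s (x + 1)).Pairwise (· ≤ ·) := (pairwise_colours _).imp le_of_lt
  by_cases hx : ∃ j, s j = x
  · obtain ⟨j, hj⟩ := hx
    rw [content_eq_singleton hj] at hperm ⊢
    have hout : (rowInsert (carrier s x) (j + 1)).2.toList = content (step s) x := by
      rcases h : rowInsert (carrier s x) (j + 1) with ⟨r, _ | y⟩
      -- All carried colours are smaller than that of `j`, so each carried ball moves while `j`
      -- still fills the box `x`.
      · refine (colours_eq_nil fun k hk => ?_).symm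
        have hle := (eq_of_rowInsert_eq_none h).2 (k + 1)
          (mem_colours.2 ⟨k, ⟨by have := lt_step s k; omega, hk.ge⟩, rfl⟩)
        rcases lt_trichotomy k j with hkj | rfl | hkj
        · exact (isLeast_step s k).1.2.1 j hkj (hj.trans hk.symm)
        · have := lt_step s k; omega
        · have := Fin.lt_def.1 hkj; omega
      -- The bumped `k` is the smallest carried colour above `j`. The box has been vacated by `j`
      -- when `k` moves, and a ball `l < k` landing there would have to satisfy `j < l`, against
      -- minimality.
      · obtain ⟨hy, hjy⟩ := rowInsert_snd_gt (congrArg Prod.snd h)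
        obtain ⟨k, ⟨hk1, hk2⟩, rfl⟩ := mem_colours.1 hy
        have hjk : j < k := Fin.lt_def.2 (by omega)
        refine (content_eq_singleton (step_eq_of_forall hk1 hk2 (fun l hl h' => ?_)
          fun l hl h' => ?_)).symm
        · obtain rfl := s.injective (hj.trans h'.symm)
          exact lt_asymm hl hjk
        · have hlj : j < l := by
            rcases lt_trichotomy l j with hlj | rfl | hlj
            · exact absurd (hj.trans h'.symm) ((isLeast_step s l).1.2.1 j hlj)
            · have := lt_step s l; omega
            · exact hlj
          have := rowInsert_snd_le hsort (congrArg Prod.snd h) (z := l + 1)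
            (mem_colours.2 ⟨l, ⟨by have := lt_step s l; omega, h'.ge⟩, rfl⟩)
            (by have := Fin.lt_def.1 hlj; omega)
          have := Fin.lt_def.1 hl
          omega
    have hp := (perm_of_rowInsert (Prod.eta (rowInsert (carrier s x) (j + 1))).symm).symm.trans hperm
    have hk := knuthEquiv_rowInsert hsort (j + 1)
    rw [hout] at hp hk
    rwa [((List.perm_append_left_iff _).1 hp).eq_of_pairwise' (pairwise_rowInsert hsort _) hsort']
      at hk
  · push Not at hx
    rw [show content s x = [] from colours_eq_nil hx, List.append_nil] at hperm ⊢
    -- At an empty box the dropped ball is the smallest carried one, so both words are the same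
    -- sorted list.
    rw [hperm.eq_of_pairwise' hsort]
    · exact .refl _
    by_cases hx' : ∃ k, step s k = x
    · obtain ⟨k, hk⟩ := hx'
      rw [content_eq_singleton hk]
      refine List.pairwise_cons.2 ⟨fun y hy => ?_, hsort'⟩
      obtain ⟨l, ⟨hl1, hl2⟩, rfl⟩ := mem_colours.1 hy
      by_contra hlk
      have hlk : l < k := Fin.lt_def.2 (by omega)
      have := step_eq_of_forall (x := x) (lt_of_le_of_ne (by omega) (hx l)) (by omega)
        (fun m _ => hx m) fun m hm h' => (hm.trans hlk).ne ((step s).injective (h'.trans hk.symm))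
      omega
    · push Not at hx'
      rwa [show content (step s) x = [] from colours_eq_nil hx']

/-- The colours of the balls in the boxes `a, a + 1, …, a + N - 1`, from left to right. -/
def windowWord (s : State n) (a : ℤ) (N : ℕ) : List ℤ :=
  (List.range N).flatMap fun i : ℕ => content s (a + i)

theorem windowWord_succ (s : State n) (a : ℤ) (N : ℕ) :
    windowWord s a (N + 1) = windowWord s a N ++ content s (a + N) := by
  simp [windowWord, List.range_succ]

theorem knuthEquiv_windowWord (s : State n) (a : ℤ) (N : ℕ) :
    KnuthEquiv (carrier s a ++ windowWord s a N) (windowWord (step s) a N ++ carrier s (a + N)) := by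
  induction N with
  | zero => simpa [windowWord] using KnuthEquiv.refl _
  | succ N ih =>
    rw [windowWord_succ, windowWord_succ, ← List.append_assoc]
    refine (ih.append_right _).trans ?_
    rw [List.append_assoc, List.append_assoc]
    refine KnuthEquiv.append_left ?_ _
    push_cast
    rw [← add_assoc]
    exact knuthEquiv_carrier s (a + N)

/-! ### The bi-word of a state -/

theorem biword_perm (s : State n) :
    (biword s).Perm (List.ofFn fun k : Fin n => (s k, (k : ℤ) + 1)) :=
  List.perm_insertionSort _ _

theorem mem_biword {s : State n} {c : ℤ × ℤ} :
    c ∈ biword s ↔ ∃ k : Fin n, (s k, (k : ℤ) + 1) = c := by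
  rw [(biword_perm s).mem_iff, List.mem_ofFn]

theorem nodup_biword (s : State n) : (biword s).Nodup := by
  rw [(biword_perm s).nodup_iff, List.nodup_ofFn]
  intro k l h
  exact s.injective (congrArg Prod.fst h)

theorem eq_of_mem_biword {s : State n} {c d : ℤ × ℤ} (hc : c ∈ biword s) (hd : d ∈ biword s)
    (h : c.1 = d.1) : c = d := by
  obtain ⟨k, rfl⟩ := mem_biword.1 hc
  obtain ⟨l, rfl⟩ := mem_biword.1 hd
  rw [s.injective h]

theorem pairwise_biword (s : State n) : (biword s).Pairwise fun c d => c.1 < d.1 := by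
  have h : (biword s).Pairwise fun c d => c.1 ≤ d.1 := by
    have : Std.Total fun c d : ℤ × ℤ => c.1 ≤ d.1 := ⟨fun c d => le_total c.1 d.1⟩
    have : IsTrans (ℤ × ℤ) fun c d => c.1 ≤ d.1 := ⟨fun _ _ _ => le_trans⟩
    exact List.pairwise_insertionSort _ _
  refine ((List.pairwise_and_iff.2 ⟨h, nodup_biword s⟩).imp_of_mem fun hc hd hcd => ?_)
  exact lt_of_le_of_ne hcd.1 fun h' => hcd.2 (eq_of_mem_biword hc hd h')

/-- The comparison is made on columns rather than colours: strictly increasing top entries determine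
a list from its set of columns. -/
theorem map_snd_biword (s : State n) {a : ℤ} {N : ℕ} (h1 : ∀ k, a ≤ s k)
    (h2 : ∀ k, s k < a + N) : (biword s).map Prod.snd = windowWord s a N := by
  have hW : biword s = (List.range N).flatMap fun i : ℕ =>
      ((List.finRange n).filter fun k => s k = a + i).map fun k => (s k, (k : ℤ) + 1) := by
    have hsort : ((List.range N).flatMap fun i : ℕ => ((List.finRange n).filter
        fun k => s k = a + i).map fun k => (s k, (k : ℤ) + 1)).Pairwise fun c d => c.1 < d.1 := by
      rw [List.pairwise_flatMap]
      refine ⟨fun i _ => ?_, List.pairwise_lt_range.imp fun {i j} hij => ?_⟩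
      · rw [List.pairwise_map]
        refine ((List.nodup_finRange n).filter _).imp_of_mem fun {k l} hk hl hkl => ?_
        have hk : s k = a + i := by simpa using hk
        have hl : s l = a + i := by simpa using hl
        exact absurd (s.injective (hk.trans hl.symm)) hkl
      · simp only [List.mem_map, List.mem_filter]
        rintro _ ⟨k, hk, rfl⟩ _ ⟨l, hl, rfl⟩
        have hk : s k = a + i := by simpa using hk
        have hl : s l = a + j := by simpa using hl
        dsimp only
        omega
    refine List.Perm.eq_of_pairwise (fun c d _ _ h h' => absurd h' h.asymm) (pairwise_biword s)
      hsort ((List.perm_ext_iff_of_nodup (nodup_biword s) (hsort.imp ?_)).2 fun c => ?_)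
    · rintro c _ hc rfl
      exact lt_irrefl _ hc
    · simp only [mem_biword, List.mem_flatMap, List.mem_range, List.mem_map, List.mem_filter,
        List.mem_finRange, true_and, decide_eq_true_eq]
      refine ⟨fun ⟨k, hk⟩ => ⟨(s k - a).toNat, ?_, k, ?_, hk⟩, fun ⟨i, _, k, _, hk⟩ => ⟨k, hk⟩⟩
      · have := h1 k; have := h2 k; omega
      · have := h1 k; omega
  rw [hW, List.map_flatMap]
  simp [windowWord, content, colours, Function.comp_def]

theorem knuthEquiv_step (s : State n) :
    KnuthEquiv ((biword s).map Prod.snd) ((biword (step s)).map Prod.snd) := by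
  obtain ⟨a, ha⟩ := (Set.finite_range s).bddBelow
  obtain ⟨b, hb⟩ := (Set.finite_range (step s)).bddAbove
  have ha : ∀ k, a ≤ s k := fun k => ha ⟨k, rfl⟩
  have hb : ∀ k, step s k ≤ b := fun k => hb ⟨k, rfl⟩
  have hlt := lt_step s
  -- The window starts no later than the first ball and ends beyond all new positions, which makes
  -- the carrier empty at both ends. For `n = 0` the truncation in `toNat` is harmless, there being
  -- no ball.
  have h (k) : step s k < a + ((b + 1 - a).toNat : ℕ) := by
    have := ha k; have := hb k; have := hlt k; omega
  rw [map_snd_biword s ha fun k => (hlt k).trans (h k),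
    map_snd_biword (step s) (fun k => (ha k).trans (hlt k).le) h]
  have := knuthEquiv_windowWord s a (b + 1 - a).toNat
  rwa [show carrier s a = [] from colours_eq_nil fun k hk => (ha k).not_gt hk.1,
    show carrier s (a + (b + 1 - a).toNat) = [] from colours_eq_nil fun k hk => (h k).not_ge hk.2,
    List.append_nil, List.nil_append] at this

theorem pSymbol_step (s : State n) : pSymbol (step s) = pSymbol s := by
  rw [pSymbol, pSymbol, rsk_fst, rsk_fst]
  exact (knuthEquiv_step s).symm.insertWord_eq

/-- Sorting the columns by colour puts the positions in the order in which the balls move, the order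
that `moveAll` follows. -/
theorem qSymbol_eq (s : State n) : qSymbol s = insertWord [] (List.ofFn s) := by
  rw [qSymbol, rsk_snd_of_perm (biword_perm s) (pairwise_biword s), List.map_ofFn]
  · rfl
  · rw [List.pairwise_ofFn]
    intro k l hkl
    have := Fin.lt_def.1 hkl
    dsimp only
    omega

theorem qSymbol_step_congr {s t : State n} (h : qSymbol s = qSymbol t) :
    qSymbol (step s) = qSymbol (step t) := by
  rw [qSymbol_eq, qSymbol_eq] at h ⊢
  rw [← moveAll_ofFn_state, ← moveAll_ofFn_state]
  exact ((knuthEquiv_of_insertWord_eq h).moveAll (List.nodup_ofFn.2 s.injective)).insertWord_eq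

end BoxBall

theorem theorem3p1 (n : ℕ) :
    (∀ s : BoxBall.State n, BoxBall.pSymbol (BoxBall.step s) = BoxBall.pSymbol s) ∧
    (∃ F : BoxBall.Tableau → BoxBall.Tableau, ∀ s : BoxBall.State n,
      BoxBall.qSymbol (BoxBall.step s) = F (BoxBall.qSymbol s)) := by
  refine ⟨BoxBall.pSymbol_step, ?_⟩
  have h : Function.FactorsThrough (fun s : BoxBall.State n => BoxBall.qSymbol (BoxBall.step s))
      BoxBall.qSymbol := fun _ _ => BoxBall.qSymbol_step_congr
  -- F is defined through any state having the given Q-symbol; on tableaux that are not Q-symbols it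
  -- takes the default value `[]`.
  exact ⟨_, fun s => (h.extend_apply (fun _ => []) s).symm⟩
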